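/- Let $\mathbf{k}$ be an algebraically closed field of characteristic $0$, and let $\mathrm{Aut}(\mathbb{A}^2)$ be the group, under composition, of automorphisms of the affine plane over $\mathbf{k}$, i.e. of polynomial maps $\phi=(f_1,f_2)$ with $f_1,f_2\in\mathbf{k}[x,y]$ that have an inverse of the same form. Then every torsion element of $\mathrm{Aut}(\mathbb{A}^2)$ is conjugate in $\mathrm{Aut}(\mathbb{A}^2)$ to a diagonal map: if $\phi\in\mathrm{Aut}(\mathbb{A}^2)$ satisfies $\phi^n=\mathrm{id}$ for some $n\geq 1$, then there exist $\alpha\in\mathrm{Aut}(\mathbb{A}^2)$ and $a,b\in\mathbf{k}\setminus\{0\}$ such that $\alpha\circ\phi\circ\alpha^{-1}=(ax,by)$. -/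

import Mathlib

/-- A polynomial map `(f₁, f₂)` of the affine plane over `k` into itself, given by its components
`f₁, f₂ ∈ k[x, y]`; here `x` is `MvPolynomial.X 0` and `y` is `MvPolynomial.X 1`. -/
@[ext]
structure PlaneEnd (k : Type*) [Field k] where
  /-- The first component. -/
  fst : MvPolynomial (Fin 2) k
  /-- The second component. -/
  snd : MvPolynomial (Fin 2) k

namespace PlaneEnd

variable {k : Type*} [Field k]

/-- The pullback `p ↦ p ∘ f = p(f₁, f₂)` along a polynomial map `f = (f₁, f₂)`. -/
noncomputable def pullback (f : PlaneEnd k) :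
    MvPolynomial (Fin 2) k →ₐ[k] MvPolynomial (Fin 2) k :=
  MvPolynomial.aeval ![f.fst, f.snd]

/-- Composition of polynomial maps: `f ∘ g = (f₁(g₁, g₂), f₂(g₁, g₂))`. -/
noncomputable def comp (f g : PlaneEnd k) : PlaneEnd k :=
  ⟨g.pullback f.fst, g.pullback f.snd⟩

/-- The identity map `(x, y)`. -/
noncomputable def id : PlaneEnd k :=
  ⟨MvPolynomial.X 0, MvPolynomial.X 1⟩

theorem pullback_id (p : MvPolynomial (Fin 2) k) : (id : PlaneEnd k).pullback p = p := by
  have h : (id : PlaneEnd k).pullback = AlgHom.id k _ := by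
    apply MvPolynomial.algHom_ext
    intro i
    fin_cases i <;> simp [pullback, id]
  simp [h]

theorem pullback_comp (f g : PlaneEnd k) (p : MvPolynomial (Fin 2) k) :
    (f.comp g).pullback p = g.pullback (f.pullback p) := by
  have h : (f.comp g).pullback = g.pullback.comp f.pullback := by
    apply MvPolynomial.algHom_ext
    intro i
    fin_cases i <;> simp [pullback, comp]
  simp [h]

/-- Polynomial maps of the plane form a monoid under composition, `f * g = f ∘ g`. -/
noncomputable instance : Monoid (PlaneEnd k) where
  mul := comp
  one := id
  mul_assoc f g h := by
    change (f.comp g).comp h = f.comp (g.comp h)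
    ext1
    · exact (pullback_comp g h f.fst).symm
    · exact (pullback_comp g h f.snd).symm
  one_mul f := by
    change (id : PlaneEnd k).comp f = f
    ext1 <;> simp [comp, id, pullback]
  mul_one f := by
    change f.comp id = f
    ext1 <;> simp [comp, pullback_id]

end PlaneEnd

/-- The group `Aut(𝔸²)` of automorphisms of the affine plane over `k`: the polynomial maps
`(f₁, f₂)` that have a polynomial inverse, under composition. -/
abbrev PlaneAut (k : Type*) [Field k] : Type _ := (PlaneEnd k)ˣ

/-- An automorphism of the plane is a diagonal map if it is `(a x, b y)` for some nonzero
`a, b ∈ k`. -/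
def PlaneAut.IsDiagonal {k : Type*} [Field k] (φ : PlaneAut k) : Prop :=
  ∃ a b : k, a ≠ 0 ∧ b ≠ 0 ∧
    (φ : PlaneEnd k) =
      ⟨MvPolynomial.C a * MvPolynomial.X 0, MvPolynomial.C b * MvPolynomial.X 1⟩

/-! By Jung's theorem the affine and the triangular automorphisms generate the group, and they play
ping-pong on degrees. For `ψ = (f, g)`, an affine non-triangular factor sends `deg f > deg g` to
`deg f ≤ deg g` and keeps the larger degree; a triangular non-affine factor goes back and raises it.
So a cyclically reduced word of at least two letters has infinite order, and a torsion element is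
conjugate to a single letter (`exists_conj_mem_of_isOfFinOrder`). An affine map becomes triangular
in coordinates adapted to an eigenvector of its linear part. A triangular map of finite order `N` is
diagonalized by averaging the coordinates over the cyclic group, since `N` is invertible in
characteristic zero.

Jung's theorem follows from a degree reduction (`exists_totalDegree_sub_lt`). Let `n = deg f ≤ m =
deg g` with `m ≥ 2`, with leading forms `F` and `G`. A coordinate is `P(f, g)`, of degree one, with
`P` involving its second variable and hence of weighted degree `W ≥ m`; so leading terms cancel, and
`G` is a root, of multiplicity `i > 0`, of the leading polynomial `p(T)` of `P(F, T)`. The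
derivation `Jac(f, ·)` acts on `k[f, g]` as `Jac(f, g) · ∂/∂g` and raises degrees by at most `n -
2`, which limits the cancellation: `W ≤ deg P(f, g) + i (n + m - 2)`. If `n ∤ m`, a root-of-unity
symmetry of `p` yields a second root of multiplicity at least `i` and violates this bound. So `m = n
s`; then `G / F ^ s` is algebraic over `k`, hence a constant `c`, and `g - c f ^ s` has smaller
degree. -/

/-! ### Ping-pong and torsion in a group generated by two submonoids -/

/-- Ping-pong along an alternating word: each letter strictly increases `D`. -/
theorem alternating_list_prod_mul {G : Type*} [Group G] {A B : Submonoid G} {S T : Set G}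
    {D : G → ℕ}
    (hA : ∀ a ∈ A, a ∉ B → ∀ ψ ∈ S, a * ψ ∈ T ∧ D ψ < D (a * ψ))
    (hB : ∀ b ∈ B, b ∉ A → ∀ ψ ∈ T, b * ψ ∈ S ∧ D ψ < D (b * ψ)) (l : List G) (x z ψ : G)
    (hl : List.IsChain (fun x y => (x ∈ A ∧ x ∉ B ∧ y ∈ B ∧ y ∉ A) ∨
      (x ∈ B ∧ x ∉ A ∧ y ∈ A ∧ y ∉ B)) (x :: (l ++ [z])))
    (hS : z ∈ A → ψ ∈ T) (hT : z ∈ B → ψ ∈ S) :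
    ((x ∈ A → (x :: l).prod * ψ ∈ T) ∧ (x ∈ B → (x :: l).prod * ψ ∈ S)) ∧
      D ψ < D ((x :: l).prod * ψ) := by
  induction l generalizing x with
  | nil =>
    simp only [List.nil_append, List.isChain_cons_cons, List.isChain_singleton, and_true] at hl
    simp only [List.prod_singleton]
    rcases hl with ⟨h1, h2, h3, h4⟩ | ⟨h1, h2, h3, h4⟩
    · have := hA x h1 h2 ψ (hT h3)
      tauto
    · have := hB x h1 h2 ψ (hS h3)
      tauto
  | cons y l ih =>
    simp only [List.cons_append, List.isChain_cons_cons] at hl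
    obtain ⟨⟨i1, i2⟩, i3⟩ := ih y hl.2
    rw [List.prod_cons, mul_assoc]
    rcases hl.1 with ⟨h1, h2, h3, h4⟩ | ⟨h1, h2, h3, h4⟩
    · have := hA x h1 h2 _ (i2 h3)
      exact ⟨⟨fun _ => this.1, fun h => absurd h h2⟩, i3.trans this.2⟩
    · have := hB x h1 h2 _ (i1 h3)
      exact ⟨⟨fun h => absurd h h2, fun _ => this.1⟩, i3.trans this.2⟩

/-- If two submonoids of a group play ping-pong, then every torsion element of the submonoid that
they generate is conjugate to an element of one of them. -/
theorem exists_conj_mem_of_isOfFinOrder {G : Type*} [Group G] {A B : Submonoid G} {S T : Set G}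
    {D : G → ℕ} (hS : S.Nonempty) (hT : T.Nonempty)
    (hA : ∀ a ∈ A, a ∉ B → ∀ ψ ∈ S, a * ψ ∈ T ∧ D ψ < D (a * ψ))
    (hB : ∀ b ∈ B, b ∉ A → ∀ ψ ∈ T, b * ψ ∈ S ∧ D ψ < D (b * ψ)) {g : G}
    (hg : g ∈ Submonoid.closure (A ∪ B : Set G)) (hfin : IsOfFinOrder g) :
    ∃ c, c * g * c⁻¹ ∈ A ∨ c * g * c⁻¹ ∈ B := by
  classical
  -- A shortest word is chosen among all words for all conjugates of `g`, so that it is also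
  -- cyclically reduced.
  have hex : ∃ n, ∃ l : List G, l.length = n ∧ (∀ x ∈ l, x ∈ A ∨ x ∈ B) ∧
      ∃ c, c * g * c⁻¹ = l.prod := by
    obtain ⟨l, hl, hp⟩ := Submonoid.exists_list_of_mem_closure hg
    exact ⟨_, l, rfl, hl, 1, by simp [hp]⟩
  obtain ⟨l, hlen, hl, c, hc⟩ := Nat.find_spec hex
  have hmin : ∀ l' : List G, (∀ x ∈ l', x ∈ A ∨ x ∈ B) → (∃ c, c * g * c⁻¹ = l'.prod) →
      l.length ≤ l'.length := fun l' h1 h2 => hlen ▸ Nat.find_min' hex ⟨l', rfl, h1, h2⟩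
  -- A rotation of the word represents another conjugate. Two cyclically adjacent letters therefore
  -- cannot be merged into one, so they lie in different submonoids.
  have hrot : ∀ x y l₁ l₂, l = l₁ ++ l₂ → ∀ m, l₂ ++ l₁ = x :: y :: m →
      (x ∈ A ∧ x ∉ B ∧ y ∈ B ∧ y ∉ A) ∨ (x ∈ B ∧ x ∉ A ∧ y ∈ A ∧ y ∉ B) := by
    intro x y l₁ l₂ h m hm
    have hmem : ∀ z ∈ x :: y :: m, z ∈ A ∨ z ∈ B := by
      intro z hz
      rw [← hm] at hz
      exact hl z (by rw [h]; simpa [or_comm] using hz)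
    have hlm : l.length = m.length + 2 := by
      have := congrArg List.length hm
      simp only [List.length_append, List.length_cons] at this
      rw [h, List.length_append]
      omega
    have hshort : ¬ (x * y ∈ A ∨ x * y ∈ B) := by
      intro hxy
      have := hmin (x * y :: m) (by
        intro z hz
        rcases List.mem_cons.1 hz with rfl | hz
        · exact hxy
        · exact hmem z (by simp [hz])) ⟨l₁.prod⁻¹ * c, by
          have e : (x * y :: m).prod = l₂.prod * l₁.prod := by
            rw [← List.prod_append, hm]
            simp [mul_assoc]
          rw [e]
          have e2 : c * g * c⁻¹ = l₁.prod * l₂.prod := by rw [hc, h, List.prod_append]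
          calc _ = l₁.prod⁻¹ * (c * g * c⁻¹) * l₁.prod := by group
            _ = _ := by rw [e2]; group⟩
      simp only [List.length_cons] at this
      omega
    have hx := hmem x (by simp)
    have hy := hmem y (by simp)
    have h1 : ¬ (x ∈ A ∧ y ∈ A) := fun h => hshort (Or.inl (mul_mem h.1 h.2))
    have h2 : ¬ (x ∈ B ∧ y ∈ B) := fun h => hshort (Or.inr (mul_mem h.1 h.2))
    tauto
  rcases l with _ | ⟨x, _ | ⟨y, l⟩⟩
  · exact ⟨c, Or.inl (by rw [hc]; exact one_mem A)⟩
  · exact ⟨c, by rw [hc]; simpa using hl x (by simp)⟩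
  exfalso
  have hchain : List.IsChain (fun x y => (x ∈ A ∧ x ∉ B ∧ y ∈ B ∧ y ∉ A) ∨
      (x ∈ B ∧ x ∉ A ∧ y ∈ A ∧ y ∉ B)) (x :: ((y :: l) ++ [x])) := by
    rw [List.isChain_iff_forall_rel_of_append_cons_cons]
    intro a b l₁ l₂ h
    -- For empty `l₂` the pair consists of the last letter and `x`; it becomes adjacent after
    -- rotating the last letter to the front.
    rcases List.eq_nil_or_concat l₂ with rfl | ⟨m, z, rfl⟩
    · obtain ⟨h3, h4⟩ : x :: y :: l = l₁ ++ [a] ∧ x = b := by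
        have h' : (x :: y :: l) ++ [x] = (l₁ ++ [a]) ++ [b] := by simpa using h
        have := List.append_inj' h' rfl
        exact ⟨this.1, by simpa using this.2⟩
      rw [← h4]
      exact hrot a x l₁ [a] h3 (l₁.tail) (by
        rcases l₁ with _ | ⟨w, l₁⟩
        · simp at h3
        · simp only [List.cons_append, List.cons.injEq] at h3
          simp [h3.1])
    · have h' : (x :: y :: l) ++ [x] = (l₁ ++ a :: b :: m) ++ [z] := by simpa using h
      have := (List.append_inj' h' rfl).1
      exact hrot a b l₁ (a :: b :: m) this (m ++ l₁) (by simp)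
  have hw : ∃ ψ : G, (x ∈ A → ψ ∈ T) ∧ (x ∈ B → ψ ∈ S) := by
    obtain ⟨s, hs⟩ := hS
    obtain ⟨t, ht⟩ := hT
    have := hrot x y [] (x :: y :: l) rfl l (by simp)
    by_cases hx : x ∈ A
    · exact ⟨t, fun _ => ht, fun h => by tauto⟩
    · exact ⟨s, fun h => absurd h hx, fun _ => hs⟩
  obtain ⟨ψ, h1, h2⟩ := hw
  set w := (x :: y :: l).prod with hwdef
  -- One pass of `w` ends in the set from which the next pass can start, because the letter that
  -- acts last on the left, `x`, is also the letter following the word in the cycle.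
  have key : ∀ n : ℕ, ((x ∈ A → w ^ n * ψ ∈ T) ∧ (x ∈ B → w ^ n * ψ ∈ S)) ∧
      D ψ + n ≤ D (w ^ n * ψ) := by
    intro n
    induction n with
    | zero => simpa using ⟨h1, h2⟩
    | succ n ih =>
      have := alternating_list_prod_mul hA hB (y :: l) x x (w ^ n * ψ) hchain ih.1.1 ih.1.2
      rw [← hwdef, ← mul_assoc, ← pow_succ'] at this
      exact ⟨this.1, by omega⟩
  obtain ⟨n, hn, hpow⟩ := isOfFinOrder_iff_pow_eq_one.1 hfin
  have hwn : w ^ n = 1 := by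
    rw [← hc, conj_pow, hpow]
    simp
  have := (key n).2
  rw [hwn, one_mul] at this
  omega

/-! ### Leading forms of products and of `Q(f, g)` -/

open MvPolynomial in
/-- Homogeneous components as coefficients along the grading `X i ↦ X i * t`. -/
theorem coeff_aeval_C_X_mul_X {σ R : Type*} [CommSemiring R] (p : MvPolynomial σ R) (j : ℕ) :
    (MvPolynomial.aeval (fun i => Polynomial.C (X i : MvPolynomial σ R) * Polynomial.X) p).coeff j
      = homogeneousComponent j p := by
  induction p using MvPolynomial.induction_on' with
  | monomial d c =>
    rw [aeval_monomial]
    have : (d.prod fun i e => (Polynomial.C (X i : MvPolynomial σ R) * Polynomial.X) ^ e) =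
        Polynomial.monomial d.degree (monomial d 1) := by
      simp only [mul_pow, Finsupp.prod_mul]
      rw [← Polynomial.C_mul_X_pow_eq_monomial, monomial_eq, Finsupp.degree_apply]
      simp only [C_1, one_mul, Finsupp.prod, map_prod, map_pow, Finset.prod_pow_eq_pow_sum]
    rw [this]
    have h2 : algebraMap R (Polynomial (MvPolynomial σ R)) c = Polynomial.C (C c) := rfl
    rw [h2, Polynomial.coeff_C_mul, Polynomial.coeff_monomial]
    classical
    rw [homogeneousComponent_of_mem (n := d.degree) (isHomogeneous_monomial c rfl)]
    by_cases hj : d.degree = j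
    · rw [if_pos hj, if_pos hj.symm, C_mul_monomial, mul_one]
    · rw [if_neg hj, if_neg (Ne.symm hj), mul_zero]
  | add p q hp hq => simp [hp, hq]

open MvPolynomial in
-- Under `X i ↦ X i * t` this is the formula for the coefficient of `t ^ (a + b)` in a product. The
-- bounds need not be attained, so either component may be zero.
theorem homogeneousComponent_mul_of_totalDegree_le {σ R : Type*} [CommSemiring R]
    {p q : MvPolynomial σ R} {a b : ℕ} (hp : p.totalDegree ≤ a) (hq : q.totalDegree ≤ b) :
    homogeneousComponent (a + b) (p * q) =
      homogeneousComponent a p * homogeneousComponent b q := by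
  have h : ∀ (p : MvPolynomial σ R) (a : ℕ), p.totalDegree ≤ a →
      (MvPolynomial.aeval (fun i => Polynomial.C (X i : MvPolynomial σ R) * Polynomial.X) p
        ).natDegree ≤ a := by
    intro p a hp
    rw [Polynomial.natDegree_le_iff_coeff_eq_zero]
    intro N hN
    rw [coeff_aeval_C_X_mul_X, homogeneousComponent_eq_zero _ _ (by omega)]
  rw [← coeff_aeval_C_X_mul_X, map_mul,
    Polynomial.coeff_mul_add_eq_of_natDegree_le (h p a hp) (h q b hq), coeff_aeval_C_X_mul_X,
    coeff_aeval_C_X_mul_X]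

open MvPolynomial in
theorem homogeneousComponent_pow_of_totalDegree_le {σ R : Type*} [CommSemiring R]
    {p : MvPolynomial σ R} {a : ℕ} (hp : p.totalDegree ≤ a) (s : ℕ) :
    homogeneousComponent (s * a) (p ^ s) = homogeneousComponent a p ^ s := by
  induction s with
  | zero => simp [homogeneousComponent_zero]
  | succ s ih =>
    rw [Nat.succ_mul, pow_succ, homogeneousComponent_mul_of_totalDegree_le
      ((totalDegree_pow p s).trans (Nat.mul_le_mul_left s hp)) hp, ih, pow_succ]

open MvPolynomial in
theorem homogeneousComponent_totalDegree_ne_zero {σ R : Type*} [CommSemiring R]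
    {p : MvPolynomial σ R} (hp : p ≠ 0) : homogeneousComponent p.totalDegree p ≠ 0 := by
  obtain ⟨d, hd, h⟩ := p.support.exists_mem_eq_sup (support_nonempty.2 hp)
    fun s => s.sum fun _ e => e
  have hdeg : d.degree = p.totalDegree := h.symm
  intro h0
  have := congrArg (coeff d) h0
  rw [coeff_homogeneousComponent, if_pos hdeg, coeff_zero] at this
  exact mem_support_iff.1 hd this

/-- If `totalDegree p ≤ a` and the component of degree `a` vanishes, then the degree drops. -/
theorem MvPolynomial.totalDegree_lt_of_homogeneousComponent_eq_zero {σ R : Type*} [CommSemiring R]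
    {p : MvPolynomial σ R} {a : ℕ} (ha : 0 < a) (hp : p.totalDegree ≤ a)
    (h : homogeneousComponent a p = 0) : p.totalDegree < a := by
  rcases hp.lt_or_eq with h1 | h1
  · exact h1
  · have : p ≠ 0 := by
      rintro rfl
      simp at h1
      omega
    exact absurd (h1 ▸ h) (homogeneousComponent_totalDegree_ne_zero this)

open MvPolynomial in
theorem aeval_pair_eq_sum {k S : Type*} [CommSemiring k] [CommSemiring S] [Algebra k S] (u v : S)
    (P : MvPolynomial (Fin 2) k) : MvPolynomial.aeval ![u, v] P =
      ∑ d ∈ P.support, algebraMap k S (P.coeff d) * (u ^ d 0 * v ^ d 1) := by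
  rw [aeval_def, eval₂_eq']
  simp [Fin.prod_univ_two]

open MvPolynomial in
-- A monomial of weight below `N` contributes only terms of degree below `N`; one of weight exactly
-- `N` contributes the product of the components of `f` and `g`.
theorem homogeneousComponent_aeval_pair {σ k : Type*} [CommSemiring k] {f g : MvPolynomial σ k}
    {n m N : ℕ} (hf : f.totalDegree ≤ n) (hg : g.totalDegree ≤ m) (Q : MvPolynomial (Fin 2) k)
    (hQ : ∀ d ∈ Q.support, d 0 * n + d 1 * m ≤ N) :
    homogeneousComponent N (MvPolynomial.aeval ![f, g] Q) =
      MvPolynomial.aeval ![homogeneousComponent n f, homogeneousComponent m g]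
        (weightedHomogeneousComponent ![n, m] N Q) := by
  classical
  rw [aeval_pair_eq_sum, weightedHomogeneousComponent_apply, map_sum, map_sum, Finset.sum_filter]
  refine Finset.sum_congr rfl fun d hd => ?_
  have hw : Finsupp.weight ![n, m] d = d 0 * n + d 1 * m := by
    simp [Finsupp.weight_apply, Finsupp.sum_fintype]
  rw [hw, algebraMap_eq, homogeneousComponent_C_mul]
  have hp0 : (f ^ d 0).totalDegree ≤ d 0 * n :=
    (totalDegree_pow f _).trans (Nat.mul_le_mul_left _ hf)
  have hp1 : (g ^ d 1).totalDegree ≤ d 1 * m :=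
    (totalDegree_pow g _).trans (Nat.mul_le_mul_left _ hg)
  split_ifs with h
  · rw [← h, homogeneousComponent_mul_of_totalDegree_le hp0 hp1,
      homogeneousComponent_pow_of_totalDegree_le hf, homogeneousComponent_pow_of_totalDegree_le hg,
      aeval_monomial, algebraMap_eq]
    simp [Finsupp.prod_fintype]
  · rw [homogeneousComponent_eq_zero, mul_zero]
    have := totalDegree_mul (f ^ d 0) (g ^ d 1)
    have := hQ d hd
    omega

/-! ### The Jacobian derivation and its effect on degrees -/

open MvPolynomial in
/-- Chain rule for a derivation and a polynomial in two variables. -/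
theorem Derivation.map_aeval_pair {k S : Type*} [CommSemiring k] [CommSemiring S] [Algebra k S]
    (D : Derivation k S S) (u v : S) (P : MvPolynomial (Fin 2) k) :
    D (MvPolynomial.aeval ![u, v] P) = MvPolynomial.aeval ![u, v] (pderiv 0 P) * D u +
      MvPolynomial.aeval ![u, v] (pderiv 1 P) * D v := by
  induction P using MvPolynomial.induction_on with
  | C a => simp
  | add p q hp hq =>
    simp only [map_add, hp, hq]
    ring
  | mul_X p i hp =>
    simp only [map_mul, Derivation.leibniz, hp, smul_eq_mul, map_add, aeval_X]
    fin_cases i <;> simp [pderiv_X] <;> ring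

namespace MvPolynomial

theorem totalDegree_pderiv_add_one_le {σ k : Type*} [CommSemiring k] {i : σ}
    {p : MvPolynomial σ k} (h : pderiv i p ≠ 0) :
    (pderiv i p).totalDegree + 1 ≤ p.totalDegree := by
  obtain ⟨d, hd, hs⟩ := (pderiv i p).support.exists_mem_eq_sup (support_nonempty.2 h)
    fun s => s.sum fun _ e => e
  have hdeg : (pderiv i p).totalDegree = d.degree := hs
  rw [mem_support_iff, coeff_pderiv] at hd
  have := le_totalDegree (mem_support_iff.2 (left_ne_zero_of_mul hd))
  change (d + Finsupp.single i 1).degree ≤ _ at this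
  rw [map_add, Finsupp.degree_single] at this
  omega

/-- The derivation `h ↦ Jac(f, h)`. -/
noncomputable def jacobianDerivation {k : Type*} [CommRing k] (f : MvPolynomial (Fin 2) k) :
    Derivation k (MvPolynomial (Fin 2) k) (MvPolynomial (Fin 2) k) :=
  pderiv 0 f • pderiv 1 - pderiv 1 f • pderiv 0

theorem jacobianDerivation_apply {k : Type*} [CommRing k] (f h : MvPolynomial (Fin 2) k) :
    jacobianDerivation f h = pderiv 0 f * pderiv 1 h - pderiv 1 f * pderiv 0 h := rfl

/-- Each partial derivative lowers the degree by at least one. Nonvanishing is needed because the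
zero polynomial has `totalDegree` zero. -/
theorem totalDegree_jacobianDerivation {k : Type*} [CommRing k] {f h : MvPolynomial (Fin 2) k}
    (hJ : jacobianDerivation f h ≠ 0) :
    (jacobianDerivation f h).totalDegree + 2 ≤ f.totalDegree + h.totalDegree := by
  have key : ∀ i j : Fin 2, pderiv i f * pderiv j h ≠ 0 →
      (pderiv i f * pderiv j h).totalDegree + 2 ≤ f.totalDegree + h.totalDegree := by
    intro i j hne
    have h1 := totalDegree_pderiv_add_one_le (left_ne_zero_of_mul hne)
    have h2 := totalDegree_pderiv_add_one_le (right_ne_zero_of_mul hne)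
    have := totalDegree_mul (pderiv i f) (pderiv j h)
    omega
  rw [jacobianDerivation_apply] at hJ ⊢
  by_cases h1 : pderiv 0 f * pderiv 1 h = 0
  · rw [h1, zero_sub] at hJ ⊢
    rw [totalDegree_neg]
    exact key 1 0 (by simpa using hJ)
  by_cases h2 : pderiv 1 f * pderiv 0 h = 0
  · rw [h2, sub_zero] at hJ ⊢
    exact key 0 1 h1
  · have h3 := key _ _ h1
    have h4 := key _ _ h2
    have := totalDegree_sub (pderiv 0 f * pderiv 1 h) (pderiv 1 f * pderiv 0 h)
    omega

/-- `Jac(f, ·)` kills `f`, so only the second term of the chain rule survives. -/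
theorem jacobianDerivation_aeval {k : Type*} [CommRing k] (f g : MvPolynomial (Fin 2) k)
    (P : MvPolynomial (Fin 2) k) : jacobianDerivation f (aeval ![f, g] P) =
      aeval ![f, g] (pderiv 1 P) * jacobianDerivation f g := by
  rw [Derivation.map_aeval_pair]
  simp [jacobianDerivation_apply, mul_comm]

/-- Two polynomials that generate `k[x, y]` have a nonzero Jacobian determinant. -/
theorem jacobianDerivation_ne_zero {k : Type*} [CommRing k] [Nontrivial k]
    {f g P Q : MvPolynomial (Fin 2) k}
    (hP : aeval ![f, g] P = X 0) (hQ : aeval ![f, g] Q = X 1) : jacobianDerivation f g ≠ 0 := by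
  have h (i : Fin 2) (T : MvPolynomial (Fin 2) k) := Derivation.map_aeval_pair (pderiv i) f g T
  have h1 := h 0 P
  have h2 := h 1 P
  have h3 := h 0 Q
  have h4 := h 1 Q
  rw [hP] at h1 h2
  rw [hQ] at h3 h4
  simp only [pderiv_X_self, ne_eq, zero_ne_one, one_ne_zero, not_false_eq_true, pderiv_X_of_ne]
    at h1 h2 h3 h4
  intro h0
  rw [jacobianDerivation_apply] at h0
  apply one_ne_zero (α := MvPolynomial (Fin 2) k)
  set a := aeval ![f, g] (pderiv 0 P)
  set b := aeval ![f, g] (pderiv 1 P)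
  set c := aeval ![f, g] (pderiv 0 Q)
  set d := aeval ![f, g] (pderiv 1 Q)
  -- By the chain rule the two Jacobian matrices multiply to the identity, so `1` is the product of
  -- their determinants.
  calc (1 : MvPolynomial (Fin 2) k) = 1 * 1 - 0 * 0 := by ring
    _ = (a * pderiv 0 f + b * pderiv 0 g) * (c * pderiv 1 f + d * pderiv 1 g) -
        (a * pderiv 1 f + b * pderiv 1 g) * (c * pderiv 0 f + d * pderiv 0 g) := by
      rw [← h1, ← h2, ← h3, ← h4]
    _ = (a * d - b * c) * (pderiv 0 f * pderiv 1 g - pderiv 1 f * pderiv 0 g) := by ring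
    _ = 0 := by rw [h0, mul_zero]

/-- Each application of `Jac(f, ·)` raises the degree by at most `deg f - 2`, and dividing the
result by the nonzero `Jac(f, g)` does not raise it. The `2 * i` stands on the left to avoid
truncated subtraction. -/
theorem totalDegree_aeval_iterate_pderiv {k : Type*} [CommRing k] [IsDomain k]
    {f g : MvPolynomial (Fin 2) k} (hJ : jacobianDerivation f g ≠ 0)
    (P : MvPolynomial (Fin 2) k) (i : ℕ) (h : aeval ![f, g] ((pderiv 1)^[i] P) ≠ 0) :
    (aeval ![f, g] ((pderiv 1)^[i] P)).totalDegree + 2 * i ≤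
      (aeval ![f, g] P).totalDegree + i * f.totalDegree := by
  induction i with
  | zero => simp
  | succ i ih =>
    rw [Function.iterate_succ_apply'] at *
    have h1 := jacobianDerivation_aeval f g ((pderiv 1)^[i] P)
    have h2 : jacobianDerivation f (aeval ![f, g] ((pderiv 1)^[i] P)) ≠ 0 := by
      rw [h1]
      exact mul_ne_zero h hJ
    have h3 := totalDegree_jacobianDerivation h2
    rw [h1, totalDegree_mul_of_isDomain h hJ] at h3
    have h4 := ih (by
      intro h0
      rw [h0, map_zero] at h2
      exact h2 rfl)
    linarith

/-! ### Weighted components under differentiation -/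

theorem weightedHomogeneousComponent_pderiv {σ k : Type*} [CommSemiring k] (w : σ → ℕ) (i : σ)
    (N : ℕ) (p : MvPolynomial σ k) : weightedHomogeneousComponent w N (pderiv i p) =
      pderiv i (weightedHomogeneousComponent w (N + w i) p) := by
  classical
  ext d
  rw [coeff_pderiv, coeff_weightedHomogeneousComponent, coeff_weightedHomogeneousComponent,
    coeff_pderiv, map_add, Finsupp.weight_single]
  simp

theorem weightedHomogeneousComponent_iterate_pderiv {σ k : Type*} [CommSemiring k] (w : σ → ℕ)
    (i : σ) (N j : ℕ) (p : MvPolynomial σ k) :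
    weightedHomogeneousComponent w N ((pderiv i)^[j] p) =
      (pderiv i)^[j] (weightedHomogeneousComponent w (N + j * w i) p) := by
  induction j generalizing N with
  | zero => simp
  | succ j ih =>
    rw [Function.iterate_succ_apply', Function.iterate_succ_apply',
      weightedHomogeneousComponent_pderiv, ih]
    congr 4
    ring

theorem weight_le_of_mem_support_iterate_pderiv {σ k : Type*} [CommSemiring k] {w : σ → ℕ} {i : σ}
    {N j : ℕ} {p : MvPolynomial σ k} (hp : ∀ d ∈ p.support, Finsupp.weight w d ≤ N + j * w i) :
    ∀ d ∈ ((pderiv i)^[j] p).support, Finsupp.weight w d ≤ N := by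
  induction j generalizing N with
  | zero => simpa using hp
  | succ j ih =>
    intro d hd
    rw [Function.iterate_succ_apply', mem_support_iff, coeff_pderiv] at hd
    have := ih (N := N + w i) (by
      intro d hd
      have := hp d hd
      linarith) _ (mem_support_iff.2 (left_ne_zero_of_mul hd))
    rw [map_add, Finsupp.weight_single] at this
    simpa using this

theorem iterate_derivative_aeval_C_X {k S : Type*} [CommSemiring k] [CommSemiring S] [Algebra k S]
    (u : S) (P : MvPolynomial (Fin 2) k) (i : ℕ) :
    Polynomial.derivative^[i] (aeval ![Polynomial.C u, Polynomial.X] P) =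
      aeval ![Polynomial.C u, Polynomial.X] ((pderiv 1)^[i] P) := by
  induction i with
  | zero => rfl
  | succ i ih =>
    rw [Function.iterate_succ_apply', Function.iterate_succ_apply', ih]
    have := Derivation.map_aeval_pair
      ((Polynomial.derivative' (R := S)).restrictScalars k) (Polynomial.C u) Polynomial.X
        ((pderiv 1)^[i] P)
    simpa using this

theorem eval_aeval_C_X {k S : Type*} [CommSemiring k] [CommSemiring S] [Algebra k S]
    (u v : S) (P : MvPolynomial (Fin 2) k) :
    (aeval ![Polynomial.C u, Polynomial.X] P : Polynomial S).eval v = aeval ![u, v] P := by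
  simp [aeval_pair_eq_sum, Polynomial.eval_finsetSum, Polynomial.algebraMap_apply]

end MvPolynomial


/-! ### The leading polynomial and Jung's degree reduction -/

namespace MvPolynomial

theorem weight_fin_two (n m : ℕ) (d : Fin 2 →₀ ℕ) :
    Finsupp.weight ![n, m] d = d 0 * n + d 1 * m := by
  simp [Finsupp.weight_apply, Finsupp.sum_fintype]

theorem aeval_C_X_eq_sum {k S : Type*} [CommSemiring k] [CommSemiring S] [Algebra k S] (u : S)
    (Q : MvPolynomial (Fin 2) k) : aeval ![Polynomial.C u, Polynomial.X] Q =
      ∑ d ∈ Q.support, Polynomial.monomial (d 1) (algebraMap k S (Q.coeff d) * u ^ d 0) := by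
  rw [aeval_pair_eq_sum]
  refine Finset.sum_congr rfl fun d _ => ?_
  rw [← Polynomial.C_mul_X_pow_eq_monomial, Polynomial.C_mul, Polynomial.C_pow,
    Polynomial.algebraMap_apply, mul_assoc]

theorem exists_mem_support_of_coeff_aeval_C_X_ne_zero {k S : Type*} [CommSemiring k]
    [CommSemiring S] [Algebra k S] {u : S} {Q : MvPolynomial (Fin 2) k} {b : ℕ}
    (h : (aeval ![Polynomial.C u, Polynomial.X] Q : Polynomial S).coeff b ≠ 0) :
    ∃ d ∈ Q.support, d 1 = b := by
  rw [aeval_C_X_eq_sum, Polynomial.finsetSum_coeff] at h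
  obtain ⟨d, hd, hne⟩ := Finset.exists_ne_zero_of_sum_ne_zero h
  refine ⟨d, hd, ?_⟩
  rw [Polynomial.coeff_monomial] at hne
  by_contra hb
  exact hne (if_neg hb)

/-- In a weighted homogeneous polynomial with `n > 0` the exponent of the second variable determines
that of the first, so distinct monomials cannot cancel. -/
theorem aeval_C_X_ne_zero {k S : Type*} [Field k] [CommRing S] [IsDomain S] [Algebra k S]
    {u : S} (hu : u ≠ 0) {Q : MvPolynomial (Fin 2) k} (hQ : Q ≠ 0) {n m N : ℕ} (hn : 0 < n)
    (hw : Q.IsWeightedHomogeneous ![n, m] N) :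
    (aeval ![Polynomial.C u, Polynomial.X] Q : Polynomial S) ≠ 0 := by
  obtain ⟨d, hd⟩ := support_nonempty.2 hQ
  intro h0
  have h1 := congrArg (fun q => Polynomial.coeff q (d 1)) h0
  simp only [aeval_C_X_eq_sum, Polynomial.finsetSum_coeff, Polynomial.coeff_monomial,
    Polynomial.coeff_zero] at h1
  rw [Finset.sum_eq_single d _ (fun h => absurd hd h), if_pos rfl] at h1
  · refine mul_ne_zero ?_ (pow_ne_zero _ hu) h1
    simpa using mem_support_iff.1 hd
  · intro e he hne
    refine if_neg fun h => hne ?_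
    have h1 := hw (mem_support_iff.1 hd)
    have h2 := hw (mem_support_iff.1 he)
    rw [weight_fin_two] at h1 h2
    ext i
    fin_cases i
    · have : e 0 * n = d 0 * n := by rw [h] at h2; omega
      exact Nat.eq_of_mul_eq_mul_right hn this
    · exact h

/-- The leading part of `P(f, g)`, with the leading form of `g` replaced by a variable. -/
noncomputable def leadingPolynomial {k : Type*} [Field k] (f g P : MvPolynomial (Fin 2) k) :
    Polynomial (MvPolynomial (Fin 2) k) :=
  aeval ![Polynomial.C (homogeneousComponent f.totalDegree f), Polynomial.X]
    (weightedHomogeneousComponent ![f.totalDegree, g.totalDegree]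
      (weightedTotalDegree ![f.totalDegree, g.totalDegree] P) P)

section

variable {k : Type*} [Field k] {f g P : MvPolynomial (Fin 2) k}

/-- This bounds the degree of the leading polynomial and fixes `b * deg g` modulo `deg f` for all
its exponents `b`. -/
theorem exists_of_coeff_leadingPolynomial_ne_zero {b : ℕ}
    (h : (leadingPolynomial f g P).coeff b ≠ 0) :
    ∃ a, a * f.totalDegree + b * g.totalDegree =
      weightedTotalDegree ![f.totalDegree, g.totalDegree] P := by
  obtain ⟨d, hd, rfl⟩ := exists_mem_support_of_coeff_aeval_C_X_ne_zero h
  exact ⟨d 0, by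
    rw [← weight_fin_two]
    exact weightedHomogeneousComponent_isWeightedHomogeneous _ _ (mem_support_iff.1 hd)⟩

theorem weightedHomogeneousComponent_weightedTotalDegree_ne_zero {σ : Type*} (w : σ → ℕ)
    {p : MvPolynomial σ k} (hp : p ≠ 0) :
    weightedHomogeneousComponent w (weightedTotalDegree w p) p ≠ 0 := by
  classical
  obtain ⟨d, hd, hs⟩ := p.support.exists_mem_eq_sup (support_nonempty.2 hp) (Finsupp.weight w)
  intro h0
  have := congrArg (coeff d) h0
  rw [coeff_weightedHomogeneousComponent,
    if_pos (show Finsupp.weight w d = weightedTotalDegree w p from hs.symm), coeff_zero] at this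
  exact mem_support_iff.1 hd this

theorem leadingPolynomial_ne_zero (hf : 0 < f.totalDegree) (hP : P ≠ 0) :
    leadingPolynomial f g P ≠ 0 := by
  refine aeval_C_X_ne_zero (homogeneousComponent_totalDegree_ne_zero ?_)
    (weightedHomogeneousComponent_weightedTotalDegree_ne_zero _ hP) hf
    (weightedHomogeneousComponent_isWeightedHomogeneous _ _)
  rintro rfl
  simp at hf

/-- The degree of `P(f, g)` bounds the weighted degree of `P`, up to the multiplicity of the
leading form of `g` as a root of the leading polynomial. -/
theorem weightedTotalDegree_add_le [CharZero k] (hJ : jacobianDerivation f g ≠ 0)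
    (hf : 0 < f.totalDegree) (hP : P ≠ 0) :
    weightedTotalDegree ![f.totalDegree, g.totalDegree] P +
        2 * (leadingPolynomial f g P).rootMultiplicity (homogeneousComponent g.totalDegree g) ≤
      (aeval ![f, g] P).totalDegree +
        (leadingPolynomial f g P).rootMultiplicity (homogeneousComponent g.totalDegree g) *
          (f.totalDegree + g.totalDegree) := by
  have hp := leadingPolynomial_ne_zero (g := g) hf hP
  set p := leadingPolynomial f g P with hpdef
  set G := homogeneousComponent g.totalDegree g
  set W := weightedTotalDegree ![f.totalDegree, g.totalDegree] P with hW
  set i := p.rootMultiplicity G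
  have hiW : i * g.totalDegree ≤ W := by
    obtain ⟨a, ha⟩ := exists_of_coeff_leadingPolynomial_ne_zero (f := f) (g := g) (P := P)
      (b := p.natDegree) (by rw [← hpdef]; simpa using hp)
    classical
    have : i ≤ p.natDegree :=
      (Polynomial.count_roots p ▸ Multiset.count_le_card G p.roots).trans p.card_roots'
    have := Nat.mul_le_mul_right g.totalDegree this
    omega
  obtain ⟨N, hN⟩ := Nat.exists_eq_add_of_le' hiW
  -- At a root of multiplicity `i` the `i`-th derivative is `i!` times a nonzero value;
  -- characteristic zero keeps `i!` nonzero.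
  have hne : (Polynomial.derivative^[i] p).eval G ≠ 0 := by
    rw [Polynomial.eval_iterate_derivative_rootMultiplicity, nsmul_eq_mul]
    refine mul_ne_zero ?_ (Polynomial.eval_divByMonic_pow_rootMultiplicity_ne_zero G hp)
    exact_mod_cast i.factorial_ne_zero
  -- The nonzero value is identified with the component of degree `N = W - i * deg g` of `(∂ⁱP)(f,
  -- g)`, whose degree is therefore at least `N`.
  rw [hpdef, leadingPolynomial, iterate_derivative_aeval_C_X, eval_aeval_C_X, ← hW, hN] at hne
  have hwt := weightedHomogeneousComponent_iterate_pderiv ![f.totalDegree, g.totalDegree] 1 N i P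
  have h1 : (![f.totalDegree, g.totalDegree] : Fin 2 → ℕ) 1 = g.totalDegree := rfl
  rw [h1] at hwt
  rw [← hwt, ← homogeneousComponent_aeval_pair le_rfl le_rfl] at hne
  · have h2 : aeval ![f, g] ((pderiv 1)^[i] P) ≠ 0 := by
      intro h0
      rw [h0, map_zero] at hne
      exact hne rfl
    have h3 := totalDegree_aeval_iterate_pderiv hJ P i h2
    have h4 : N ≤ (aeval ![f, g] ((pderiv 1)^[i] P)).totalDegree := by
      by_contra hlt
      exact hne (homogeneousComponent_eq_zero _ _ (by omega))
    rw [mul_add]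
    omega
  · intro d hd
    rw [← weight_fin_two]
    refine weight_le_of_mem_support_iterate_pderiv (i := 1) (j := i) (p := P) (fun e he => ?_) d hd
    rw [h1, ← hN]
    exact le_weightedTotalDegree _ he

/-- Otherwise `Jac(f, x) = Jac(f, y) = 0`, so both partial derivatives of `f` vanish, and with them
`Jac(f, g)`. -/
theorem exists_pderiv_one_ne_zero {Q : MvPolynomial (Fin 2) k}
    (hP : aeval ![f, g] P = X 0) (hQ : aeval ![f, g] Q = X 1) :
    pderiv 1 P ≠ 0 ∨ pderiv 1 Q ≠ 0 := by
  have hJ := jacobianDerivation_ne_zero hP hQ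
  by_contra! h
  have h1 := jacobianDerivation_aeval f g P
  have h2 := jacobianDerivation_aeval f g Q
  rw [hP, h.1, jacobianDerivation_apply] at h1
  rw [hQ, h.2, jacobianDerivation_apply] at h2
  simp at h1 h2
  rw [jacobianDerivation_apply, h1, h2] at hJ
  simp at hJ

/-- If the degrees of `f` and `g` do not both equal one, then cancellation of leading forms has to
occur when a coordinate is expressed through `f` and `g`. -/
theorem isRoot_leadingPolynomial [CharZero k] (hJ : jacobianDerivation f g ≠ 0)
    (hf : 0 < f.totalDegree) (hg : 2 ≤ g.totalDegree) (hd : (aeval ![f, g] P).totalDegree ≤ 1)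
    (hP : pderiv 1 P ≠ 0) :
    0 < (leadingPolynomial f g P).rootMultiplicity (homogeneousComponent g.totalDegree g) := by
  by_contra! h
  have hP0 : P ≠ 0 := by
    rintro rfl
    simp at hP
  have h1 := weightedTotalDegree_add_le hJ hf hP0
  rw [Nat.le_zero.1 h] at h1
  -- Without a root the weighted degree of `P` is at most one, yet `P` has a monomial divisible by
  -- the second variable, of weight at least `deg g ≥ 2`.
  obtain ⟨e, he⟩ := support_nonempty.2 hP
  rw [mem_support_iff, coeff_pderiv] at he
  have h2 := le_weightedTotalDegree ![f.totalDegree, g.totalDegree]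
    (mem_support_iff.2 (left_ne_zero_of_mul he))
  rw [weight_fin_two] at h2
  simp only [Finsupp.coe_add, Pi.add_apply, Finsupp.single_eq_same, add_mul] at h2
  omega

/-- If `deg f ∤ deg g`, weighted homogeneity makes the leading polynomial invariant, up to a scalar,
under scaling its variable by a root of unity `ζ ≠ 1`. Then `ζ⁻¹ G` is another root of multiplicity
at least that of `G`, and the weighted degree of `P` becomes too large for
`weightedTotalDegree_add_le`. -/
theorem totalDegree_dvd_totalDegree [IsAlgClosed k] [CharZero k]
    (hJ : jacobianDerivation f g ≠ 0) (hf : 0 < f.totalDegree)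
    (hfg : f.totalDegree ≤ g.totalDegree) (hd : (aeval ![f, g] P).totalDegree ≤ 1) (hP : P ≠ 0)
    (hpos : 0 < (leadingPolynomial f g P).rootMultiplicity
      (homogeneousComponent g.totalDegree g)) :
    f.totalDegree ∣ g.totalDegree := by
  have h1 := weightedTotalDegree_add_le hJ hf hP
  have hp := leadingPolynomial_ne_zero (g := g) hf hP
  set n := f.totalDegree
  set m := g.totalDegree
  set W := weightedTotalDegree ![n, m] P
  set G := homogeneousComponent m g
  have hcoeff (b : ℕ) := exists_of_coeff_leadingPolynomial_ne_zero (f := f) (g := g) (P := P)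
    (b := b)
  set p := leadingPolynomial f g P
  set i := p.rootMultiplicity G
  by_contra hndvd
  have hG : G ≠ 0 := homogeneousComponent_totalDegree_ne_zero (by
    rintro rfl
    exact hndvd (by simp [m]))
  set r := n / n.gcd m with hr
  have hgpos : 0 < n.gcd m := Nat.gcd_pos_of_pos_left _ hf
  have hn : n = n.gcd m * r := (Nat.mul_div_cancel' (Nat.gcd_dvd_left n m)).symm
  have hr1 : r ≠ 1 := fun h => hndvd (by
    rw [h, mul_one] at hn
    exact hn ▸ Nat.gcd_dvd_right n m)
  have hr0 : r ≠ 0 := fun h => by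
    rw [h, mul_zero] at hn
    omega
  have : NeZero (r : k) := ⟨by exact_mod_cast hr0⟩
  obtain ⟨ζ, hζ⟩ := HasEnoughRootsOfUnity.exists_primitiveRoot k r
  have hζ0 : ζ ≠ 0 := hζ.ne_zero hr0
  have hζ1 : ζ ≠ 1 := hζ.ne_one (Nat.one_lt_iff_ne_zero_and_ne_one.2 ⟨hr0, hr1⟩)
  -- All exponents `b` of `p` share the residue of `b * m` modulo `n`, hence that of `b` modulo `r =
  -- n / gcd(n, m)`.
  have hmod : ∀ b, p.coeff b ≠ 0 → ζ ^ b = ζ ^ p.natDegree := by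
    intro b hb
    obtain ⟨a, ha⟩ := hcoeff b hb
    obtain ⟨a', ha'⟩ := hcoeff p.natDegree (by simpa using hp)
    have hmodn : b * m ≡ p.natDegree * m [MOD n] := by
      have e : a * n + b * m = a' * n + p.natDegree * m := ha.trans ha'.symm
      have := congrArg (· % n) e
      simpa [Nat.ModEq] using this
    have := hmodn.cancel_right_div_gcd hf
    rw [← hr] at this
    exact pow_eq_pow_of_modEq this hζ.pow_eq_one
  have hscale : p.comp (Polynomial.C (C ζ) * Polynomial.X) =
      Polynomial.C (C (ζ ^ p.natDegree)) * p := by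
    ext1 b
    rw [Polynomial.comp_C_mul_X_coeff, Polynomial.coeff_C_mul]
    by_cases hb : p.coeff b = 0
    · simp [hb]
    · rw [← hmod b hb, C_pow, mul_comm]
  have hG' : i ≤ p.rootMultiplicity (C ζ⁻¹ * G) := by
    rw [Polynomial.le_rootMultiplicity_iff hp]
    have h2 : (Polynomial.X - Polynomial.C G) ^ i ∣ p := p.pow_rootMultiplicity_dvd G
    have h3 := map_dvd (Polynomial.compRingHom (Polynomial.C (C ζ) * Polynomial.X)) h2
    rw [map_pow, Polynomial.coe_compRingHom_apply, Polynomial.coe_compRingHom_apply, hscale] at h3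
    have e : (Polynomial.X - Polynomial.C G).comp (Polynomial.C (C ζ) * Polynomial.X) =
        Polynomial.C (C ζ) * (Polynomial.X - Polynomial.C (C ζ⁻¹ * G)) := by
      rw [Polynomial.sub_comp, Polynomial.X_comp, Polynomial.C_comp, mul_sub, ← Polynomial.C_mul,
        ← mul_assoc, ← C_mul, mul_inv_cancel₀ hζ0, C_1, one_mul]
    rw [e, mul_pow] at h3
    have hu : IsUnit (Polynomial.C (C (ζ ^ p.natDegree)) :
        Polynomial (MvPolynomial (Fin 2) k)) :=
      ((isUnit_iff_ne_zero.2 (pow_ne_zero _ hζ0)).map C).map Polynomial.C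
    exact (hu.dvd_mul_left).1 ((dvd_mul_left _ _).trans h3)
  have hne : G ≠ C ζ⁻¹ * G := by
    intro h
    have h2 : (1 : MvPolynomial (Fin 2) k) = C ζ⁻¹ := mul_right_cancel₀ hG (by rw [one_mul, ← h])
    rw [← C_1] at h2
    have := C_injective _ _ h2
    exact hζ1 (inv_eq_one.1 this.symm)
  have hcard : 2 * i ≤ p.natDegree := by
    classical
    have : Multiset.replicate i G + Multiset.replicate i (C ζ⁻¹ * G) ≤ p.roots := by
      rw [Multiset.le_iff_count]
      intro x
      rw [Multiset.count_add, Multiset.count_replicate, Multiset.count_replicate,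
        Polynomial.count_roots]
      split_ifs with h3 h4 h4
      · exact absurd (h3.trans h4.symm) hne
      · rw [← h3, add_zero]
      · rw [← h4, zero_add]
        exact hG'
      · simp
    have := (Multiset.card_le_card this).trans p.card_roots'
    rw [Multiset.card_add, Multiset.card_replicate, Multiset.card_replicate] at this
    omega
  -- Two roots of multiplicity `i` give `W ≥ 2 i m`, whereas `W + 2 i ≤ 1 + i (n + m) ≤ 1 + 2 i m`.
  -- This forces `i = 0`.
  obtain ⟨a', ha'⟩ := hcoeff p.natDegree (by simpa using hp)
  have h5 := Nat.mul_le_mul_right m hcard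
  have h6 : i * n ≤ i * m := Nat.mul_le_mul_left i hfg
  have h7 : 2 * (i * m) ≤ W := by
    change a' * n + p.natDegree * m = W at ha'
    linarith [Nat.zero_le (a' * n)]
  rw [mul_add] at h1
  omega

/-- Setting `F = 1` in the leading polynomial leaves a nonzero polynomial `r` over `k` with root `G
/ F ^ s` in the fraction field. Since `k` is algebraically closed, that root is a constant. -/
theorem homogeneousComponent_eq_C_mul_pow [IsAlgClosed k] {s : ℕ} (hf : 0 < f.totalDegree)
    (hs : g.totalDegree = f.totalDegree * s) (hP : P ≠ 0)
    (hpos : 0 < (leadingPolynomial f g P).rootMultiplicity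
      (homogeneousComponent g.totalDegree g)) :
    ∃ c : k, homogeneousComponent g.totalDegree g =
      C c * homogeneousComponent f.totalDegree f ^ s := by
  have hroot := (Polynomial.rootMultiplicity_pos (leadingPolynomial_ne_zero hf hP)).1 hpos
  have hF : homogeneousComponent f.totalDegree f ≠ 0 :=
    homogeneousComponent_totalDegree_ne_zero (by
      rintro rfl
      simp at hf)
  rw [leadingPolynomial, Polynomial.IsRoot.def, eval_aeval_C_X, aeval_pair_eq_sum] at hroot
  have hhom := weightedHomogeneousComponent_isWeightedHomogeneous (w := ![f.totalDegree,
    g.totalDegree]) (weightedTotalDegree ![f.totalDegree, g.totalDegree] P) P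
  have hne := weightedHomogeneousComponent_weightedTotalDegree_ne_zero
    ![f.totalDegree, g.totalDegree] hP
  set Q := weightedHomogeneousComponent ![f.totalDegree, g.totalDegree]
    (weightedTotalDegree ![f.totalDegree, g.totalDegree] P) P
  set F := homogeneousComponent f.totalDegree f
  set G := homogeneousComponent g.totalDegree g
  set W := weightedTotalDegree ![f.totalDegree, g.totalDegree] P
  have hr : (aeval ![Polynomial.C 1, Polynomial.X] Q : Polynomial k) ≠ 0 :=
    aeval_C_X_ne_zero one_ne_zero hne hf hhom
  set r : Polynomial k := aeval ![Polynomial.C 1, Polynomial.X] Q with hrdef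
  let K := FractionRing (MvPolynomial (Fin 2) k)
  let ι := algebraMap (MvPolynomial (Fin 2) k) K
  have hι : Function.Injective ι := IsFractionRing.injective _ _
  have hF' : ι F ≠ 0 := (map_ne_zero_iff ι hι).2 hF
  have hz : Polynomial.aeval (ι G / ι F ^ s) r = 0 := by
    -- As `deg g = deg f * s`, every monomial of `Q` satisfies `d 0 + s * d 1 = W / deg f`. Hence
    -- `Q(F, G) = F ^ (W / deg f) * r(G / F ^ s)`.
    have h1 : ι F ^ (W / f.totalDegree) * Polynomial.aeval (ι G / ι F ^ s) r = 0 := by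
      rw [← map_zero ι, ← hroot, map_sum, hrdef, aeval_C_X_eq_sum, map_sum, Finset.mul_sum]
      refine Finset.sum_congr rfl fun d hd => ?_
      have hw := hhom (mem_support_iff.1 hd)
      rw [weight_fin_two, hs] at hw
      have hW : W / f.totalDegree = d 0 + s * d 1 := by
        rw [← hw, show d 0 * f.totalDegree + d 1 * (f.totalDegree * s) =
          f.totalDegree * (d 0 + s * d 1) by ring, Nat.mul_div_cancel_left _ hf]
      rw [hW, Polynomial.aeval_monomial, div_pow, ← pow_mul, pow_add, one_pow, mul_one, map_mul,
        map_mul, map_pow, map_pow, Algebra.algebraMap_self, RingHom.id_apply,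
        IsScalarTower.algebraMap_apply k (MvPolynomial (Fin 2) k) K]
      change _ = algebraMap (MvPolynomial (Fin 2) k) K _ * _
      have hq : ι F ^ (s * d 1) * (ι G ^ d 1 / ι F ^ (s * d 1)) = ι G ^ d 1 :=
        mul_div_cancel₀ _ (pow_ne_zero _ hF')
      conv_rhs => rw [← hq]
      ac_rfl
    exact (mul_eq_zero.1 h1).resolve_left (pow_ne_zero _ hF')
  obtain ⟨c, hc⟩ := (IsAlgClosed.splits r).mem_range_of_isRoot (S := K) hr (by
    rw [Polynomial.IsRoot.def, Polynomial.eval_map_algebraMap, hz])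
  refine ⟨c, hι ?_⟩
  rw [eq_div_iff (pow_ne_zero _ hF')] at hc
  rw [← hc, map_mul, map_pow, ← algebraMap_eq, ← IsScalarTower.algebraMap_apply]

/-- Jung's reduction: the second component of an automorphism of the plane, if it has the larger
degree and is not linear, can be reduced in degree by a multiple of a power of the first one. -/
theorem exists_totalDegree_sub_lt [IsAlgClosed k] [CharZero k] {Q : MvPolynomial (Fin 2) k}
    (hP : aeval ![f, g] P = X 0) (hQ : aeval ![f, g] Q = X 1)
    (hfg : f.totalDegree ≤ g.totalDegree) (hg : 2 ≤ g.totalDegree) :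
    ∃ (c : k) (s : ℕ), (g - C c * f ^ s).totalDegree < g.totalDegree := by
  have hJ := jacobianDerivation_ne_zero hP hQ
  have hf : 0 < f.totalDegree := by
    by_contra! h
    rw [Nat.le_zero, totalDegree_eq_zero_iff_eq_C] at h
    rw [h, jacobianDerivation_apply] at hJ
    simp at hJ
  obtain ⟨T, hT, hTd⟩ : ∃ T : MvPolynomial (Fin 2) k, pderiv 1 T ≠ 0 ∧
      (aeval ![f, g] T).totalDegree ≤ 1 := by
    rcases exists_pderiv_one_ne_zero hP hQ with h | h
    · exact ⟨P, h, by rw [hP, totalDegree_X]⟩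
    · exact ⟨Q, h, by rw [hQ, totalDegree_X]⟩
  have hpos := isRoot_leadingPolynomial hJ hf hg hTd hT
  have hT0 : T ≠ 0 := by
    rintro rfl
    simp at hT
  obtain ⟨s, hs⟩ := totalDegree_dvd_totalDegree hJ hf hfg hTd hT0 hpos
  obtain ⟨c, hc⟩ := homogeneousComponent_eq_C_mul_pow hf hs hT0 hpos
  refine ⟨c, s, totalDegree_lt_of_homogeneousComponent_eq_zero (by omega) ?_ ?_⟩
  · refine (totalDegree_sub _ _).trans (max_le le_rfl ?_)
    refine (totalDegree_mul _ _).trans ?_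
    rw [totalDegree_C, zero_add, hs, mul_comm]
    exact totalDegree_pow f s
  · have := homogeneousComponent_pow_of_totalDegree_le (p := f) le_rfl s
    rw [mul_comm, ← hs] at this
    rw [map_sub, homogeneousComponent_C_mul, this, hc, sub_self]

end

end MvPolynomial


/-! ### Polynomials of degree at most one and degrees of composites -/

namespace MvPolynomial

theorem exists_eq_of_totalDegree_le_one {k : Type*} [CommSemiring k] {p : MvPolynomial (Fin 2) k}
    (hp : p.totalDegree ≤ 1) : ∃ a b c : k, p = C a * X 0 + C b * X 1 + C c := by
  classical
  refine ⟨p.coeff (Finsupp.single 0 1), p.coeff (Finsupp.single 1 1), p.coeff 0, ?_⟩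
  ext d
  simp only [coeff_add, coeff_C_mul, coeff_X, coeff_C]
  have h01 : (Finsupp.single 0 1 : Fin 2 →₀ ℕ) ≠ Finsupp.single 1 1 := by
    simp [Finsupp.single_left_inj]
  by_cases h0 : d = 0
  · subst h0
    simp
  by_cases h1 : d = Finsupp.single 0 1
  · subst h1
    simp [h01.symm, Ne.symm h0]
  by_cases h2 : d = Finsupp.single 1 1
  · subst h2
    simp [h01, Ne.symm h0]
  rw [if_neg (Ne.symm h1), if_neg (Ne.symm h2), if_neg (Ne.symm h0)]
  simp only [mul_zero, add_zero]
  refine coeff_eq_zero_of_totalDegree_lt (hp.trans_lt ?_)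
  change 1 < d.degree
  rw [Finsupp.degree_eq_sum, Fin.sum_univ_two]
  by_contra! hle
  have : d 0 = 0 ∧ d 1 = 0 ∨ d 0 = 1 ∧ d 1 = 0 ∨ d 0 = 0 ∧ d 1 = 1 := by omega
  rcases this with h | h | h
  · exact h0 (by ext i; fin_cases i <;> simp [h])
  · exact h1 (by ext i; fin_cases i <;> simp [h])
  · exact h2 (by ext i; fin_cases i <;> simp [h])

theorem totalDegree_C_mul_of_ne_zero {σ k : Type*} [CommRing k] [IsDomain k] {c : k} (hc : c ≠ 0)
    (p : MvPolynomial σ k) : (C c * p).totalDegree = p.totalDegree := by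
  by_cases hp : p = 0
  · simp [hp]
  · rw [totalDegree_mul_of_isDomain (by simpa using hc) hp, totalDegree_C, zero_add]

theorem totalDegree_C_mul_le {σ k : Type*} [CommSemiring k] (c : k) (p : MvPolynomial σ k) :
    (C c * p).totalDegree ≤ p.totalDegree :=
  (totalDegree_mul _ _).trans (by simp)

theorem totalDegree_pow_of_isDomain {σ k : Type*} [CommRing k] [IsDomain k]
    (p : MvPolynomial σ k) (n : ℕ) : (p ^ n).totalDegree = n * p.totalDegree := by
  by_cases hp : p = 0
  · rcases n with _ | n <;> simp [hp]
  induction n with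
  | zero => simp
  | succ n ih => rw [pow_succ, totalDegree_mul_of_isDomain (pow_ne_zero _ hp) hp, ih, Nat.succ_mul]

theorem totalDegree_polynomial_aeval_le {σ k : Type*} [CommSemiring k] (p : MvPolynomial σ k)
    (q : Polynomial k) : (Polynomial.aeval p q).totalDegree ≤ q.natDegree * p.totalDegree := by
  rw [Polynomial.aeval_eq_sum_range]
  refine totalDegree_finsetSum_le fun i hi => ?_
  refine (totalDegree_smul_le _ _).trans ((totalDegree_pow p i).trans ?_)
  exact Nat.mul_le_mul_right _ (Nat.lt_succ_iff.1 (Finset.mem_range.1 hi))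

theorem totalDegree_polynomial_aeval {σ k : Type*} [CommRing k] [IsDomain k]
    (p : MvPolynomial σ k) (q : Polynomial k) :
    (Polynomial.aeval p q).totalDegree = q.natDegree * p.totalDegree := by
  rcases Nat.eq_zero_or_pos q.natDegree with hq | hq
  · rw [Polynomial.eq_C_of_natDegree_eq_zero hq]
    simp
  rcases Nat.eq_zero_or_pos p.totalDegree with hp | hp
  · have := totalDegree_polynomial_aeval_le p q
    rw [hp, mul_zero] at *
    omega
  have hq0 : q ≠ 0 := by
    rintro rfl
    simp at hq
  have h1 : (C q.leadingCoeff * p ^ q.natDegree).totalDegree = q.natDegree * p.totalDegree := by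
    rw [totalDegree_C_mul_of_ne_zero (by simpa using hq0), totalDegree_pow_of_isDomain]
  have h2 : (Polynomial.aeval p q.eraseLead).totalDegree < q.natDegree * p.totalDegree := by
    refine (totalDegree_polynomial_aeval_le p _).trans_lt (Nat.mul_lt_mul_of_pos_right ?_ hp)
    exact q.eraseLead_natDegree_le.trans_lt (by omega)
  conv_lhs => rw [← q.eraseLead_add_monomial_natDegree_leadingCoeff]
  rw [map_add, Polynomial.aeval_monomial, algebraMap_eq,
    totalDegree_add_eq_right_of_totalDegree_lt (by rw [h1]; exact h2), h1]

end MvPolynomial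

/-! ### Affine and triangular automorphisms -/

open MvPolynomial in
theorem PlaneEnd.pullback_X_zero {k : Type*} [Field k] (f : PlaneEnd k) :
    f.pullback (X 0) = f.fst := by
  simp [PlaneEnd.pullback]

open MvPolynomial in
theorem PlaneEnd.pullback_X_one {k : Type*} [Field k] (f : PlaneEnd k) :
    f.pullback (X 1) = f.snd := by
  simp [PlaneEnd.pullback]

open MvPolynomial in
theorem PlaneEnd.pullback_C {k : Type*} [Field k] (f : PlaneEnd k) (c : k) :
    f.pullback (C c) = C c := by
  simp [PlaneEnd.pullback]

open MvPolynomial in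
theorem PlaneEnd.pullback_aeval {k : Type*} [Field k] (f : PlaneEnd k)
    (p : MvPolynomial (Fin 2) k) (q : Polynomial k) :
    f.pullback (Polynomial.aeval p q) = Polynomial.aeval (f.pullback p) q :=
  (Polynomial.aeval_algHom_apply _ _ _).symm

theorem PlaneEnd.mul_fst {k : Type*} [Field k] (f g : PlaneEnd k) :
    (f * g).fst = g.pullback f.fst := rfl

theorem PlaneEnd.mul_snd {k : Type*} [Field k] (f g : PlaneEnd k) :
    (f * g).snd = g.pullback f.snd := rfl

theorem PlaneEnd.one_fst {k : Type*} [Field k] :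
    (1 : PlaneEnd k).fst = MvPolynomial.X 0 := rfl

theorem PlaneEnd.one_snd {k : Type*} [Field k] :
    (1 : PlaneEnd k).snd = MvPolynomial.X 1 := rfl

namespace PlaneAut

open MvPolynomial PlaneEnd

variable {k : Type*} [Field k]

/-- The automorphism `(y, x)`. -/
noncomputable def swap : PlaneAut k where
  val := ⟨X 1, X 0⟩
  inv := ⟨X 1, X 0⟩
  val_inv := by ext1 <;> simp [mul_fst, mul_snd, one_fst, one_snd, pullback_X_zero, pullback_X_one]
  inv_val := by ext1 <;> simp [mul_fst, mul_snd, one_fst, one_snd, pullback_X_zero, pullback_X_one]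

/-- The automorphism `(x + P(y), y + c)`. -/
noncomputable def shear (P : Polynomial k) (c : k) : PlaneAut k where
  val := ⟨X 0 + Polynomial.aeval (X 1) P, X 1 + C c⟩
  inv := ⟨X 0 - Polynomial.aeval (X 1 - C c) P, X 1 - C c⟩
  val_inv := by
    ext1 <;> simp [mul_fst, mul_snd, one_fst, one_snd, pullback_X_zero, pullback_X_one,
      pullback_aeval]
  inv_val := by
    ext1 <;> simp [mul_fst, mul_snd, one_fst, one_snd, pullback_X_zero, pullback_X_one,
      pullback_aeval]

/-- The automorphism `(a x, b y)`. -/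
noncomputable def diagonal (a b : kˣ) : PlaneAut k where
  val := ⟨C (a : k) * X 0, C (b : k) * X 1⟩
  inv := ⟨C ((a⁻¹ : kˣ) : k) * X 0, C ((b⁻¹ : kˣ) : k) * X 1⟩
  val_inv := by
    ext1 <;> simp [mul_fst, mul_snd, one_fst, one_snd, pullback_X_zero, pullback_X_one,
      ← mul_assoc, ← C_mul]
  inv_val := by
    ext1 <;> simp [mul_fst, mul_snd, one_fst, one_snd, pullback_X_zero, pullback_X_one,
      ← mul_assoc, ← C_mul]

/-- The automorphism `(x, y + P(x))`. -/
noncomputable def lowerShear (P : Polynomial k) : PlaneAut k :=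
  swap * shear P 0 * swap

theorem coe_lowerShear (P : Polynomial k) :
    (lowerShear P : PlaneEnd k) = ⟨X 0, X 1 + Polynomial.aeval (X 0) P⟩ := by
  ext1 <;> simp [lowerShear, swap, shear, mul_fst, mul_snd, pullback_X_zero, pullback_X_one,
      pullback_aeval]

theorem lowerShear_mul_lowerShear_neg (P : Polynomial k) :
    lowerShear P * lowerShear (-P) = 1 := by
  ext1
  rw [Units.val_mul, coe_lowerShear, coe_lowerShear]
  ext1 <;> simp [mul_fst, mul_snd, one_fst, one_snd, pullback_X_zero, pullback_X_one,
      pullback_aeval]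

/-- The affine automorphisms. -/
def affine (k : Type*) [Field k] : Submonoid (PlaneAut k) where
  carrier := {φ | ∃ a b c a' b' c' : k,
    (φ : PlaneEnd k) = ⟨C a * X 0 + C b * X 1 + C c, C a' * X 0 + C b' * X 1 + C c'⟩}
  one_mem' := ⟨1, 0, 0, 0, 1, 0, by ext1 <;> simp [one_fst, one_snd]⟩
  mul_mem' := by
    rintro φ ψ ⟨a, b, c, a', b', c', h⟩ ⟨p, q, r, p', q', r', h'⟩
    refine ⟨a * p + b * p', a * q + b * q', a * r + b * r' + c, a' * p + b' * p',
      a' * q + b' * q', a' * r + b' * r' + c', ?_⟩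
    rw [Units.val_mul, h, h']
    ext1 <;> simp only [mul_fst, mul_snd, map_add, map_mul, pullback_C, pullback_X_zero,
      pullback_X_one] <;> ring

/-- The triangular automorphisms `(a x + P(y), b y + c)`. -/
def triangular (k : Type*) [Field k] : Submonoid (PlaneAut k) where
  carrier := {φ | ∃ (a : k) (P : Polynomial k) (b c : k),
    (φ : PlaneEnd k) = ⟨C a * X 0 + Polynomial.aeval (X 1) P, C b * X 1 + C c⟩}
  one_mem' := ⟨1, 0, 1, 0, by ext1 <;> simp [one_fst, one_snd]⟩
  mul_mem' := by
    rintro φ ψ ⟨a, P, b, c, h⟩ ⟨a', P', b', c', h'⟩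
    refine ⟨a * a', Polynomial.C a * P' + P.comp (Polynomial.C b' * Polynomial.X +
      Polynomial.C c'), b * b', b * c' + c, ?_⟩
    rw [Units.val_mul, h, h']
    ext1 <;> simp only [mul_fst, mul_snd, map_add, map_mul, pullback_C, pullback_X_zero,
      pullback_X_one, pullback_aeval, Polynomial.aeval_comp, Polynomial.aeval_C,
      Polynomial.aeval_X, algebraMap_eq] <;> ring

theorem mem_affine {φ : PlaneAut k} : φ ∈ affine k ↔ ∃ a b c a' b' c' : k,
    (φ : PlaneEnd k) = ⟨C a * X 0 + C b * X 1 + C c, C a' * X 0 + C b' * X 1 + C c'⟩ := Iff.rfl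

theorem mem_triangular {φ : PlaneAut k} :
    φ ∈ triangular k ↔ ∃ (a : k) (P : Polynomial k) (b c : k),
      (φ : PlaneEnd k) = ⟨C a * X 0 + Polynomial.aeval (X 1) P, C b * X 1 + C c⟩ := Iff.rfl

theorem aeval_inv_fst (φ : PlaneAut k) :
    aeval ![φ.val.fst, φ.val.snd] φ.inv.fst = X 0 :=
  congrArg PlaneEnd.fst φ.inv_val

theorem aeval_inv_snd (φ : PlaneAut k) :
    aeval ![φ.val.fst, φ.val.snd] φ.inv.snd = X 1 :=
  congrArg PlaneEnd.snd φ.inv_val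

theorem swap_mem_affine : (swap : PlaneAut k) ∈ affine k :=
  mem_affine.2 ⟨0, 1, 0, 1, 0, 0, by ext1 <;> simp [swap]⟩

theorem shear_mem_triangular (P : Polynomial k) (c : k) : shear P c ∈ triangular k :=
  mem_triangular.2 ⟨1, P, 1, c, by ext1 <;> simp [shear]⟩

/-! ### Generation by affine and triangular automorphisms -/

/-- **Jung's theorem**: the affine and the triangular automorphisms generate the automorphism group
of the plane. -/
theorem mem_closure_affine_union_triangular [IsAlgClosed k] [CharZero k] (φ : PlaneAut k) :
    φ ∈ Submonoid.closure (affine k ∪ triangular k : Set (PlaneAut k)) := by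
  have hsw : (swap : PlaneAut k) ∈ Submonoid.closure (affine k ∪ triangular k : Set (PlaneAut k)) :=
    Submonoid.subset_closure (Or.inl swap_mem_affine)
  induction hN : φ.val.fst.totalDegree + φ.val.snd.totalDegree using Nat.strong_induction_on
    generalizing φ with
  | _ N ih =>
  -- Up to `swap` the second component has the larger degree. Either a lower shear reduces that
  -- degree, or both components have degree at most one and the map is affine.
  have main : ∀ ψ : PlaneAut k, ψ.val.fst.totalDegree + ψ.val.snd.totalDegree = N →
      ψ.val.fst.totalDegree ≤ ψ.val.snd.totalDegree →
      ψ ∈ Submonoid.closure (affine k ∪ triangular k : Set (PlaneAut k)) := by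
    intro ψ hψ hle
    rcases Nat.lt_or_ge 1 ψ.val.snd.totalDegree with hlt | hone
    · obtain ⟨c, s, hcs⟩ := exists_totalDegree_sub_lt (aeval_inv_fst ψ) (aeval_inv_snd ψ) hle hlt
      set P : Polynomial k := Polynomial.C c * Polynomial.X ^ s with hP
      have h1 : (lowerShear (-P) * ψ).val = ⟨ψ.val.fst, ψ.val.snd - C c * ψ.val.fst ^ s⟩ := by
        rw [Units.val_mul, coe_lowerShear]
        ext1 <;> simp [mul_fst, mul_snd, pullback_X_zero, pullback_X_one, hP,
          sub_eq_add_neg]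
      have h2 := ih _ (by rw [← hψ]; exact Nat.add_lt_add_left hcs _) (lowerShear (-P) * ψ)
        (by rw [h1])
      have h3 : ψ = lowerShear P * (lowerShear (-P) * ψ) := by
        rw [← mul_assoc, lowerShear_mul_lowerShear_neg, one_mul]
      rw [h3]
      exact mul_mem (mul_mem (mul_mem hsw
        (Submonoid.subset_closure (Or.inr (shear_mem_triangular P 0)))) hsw) h2
    · obtain ⟨a, b, c, h⟩ := exists_eq_of_totalDegree_le_one (hle.trans hone)
      obtain ⟨a', b', c', h'⟩ := exists_eq_of_totalDegree_le_one hone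
      exact Submonoid.subset_closure (Or.inl (mem_affine.2 ⟨a, b, c, a', b', c', by
        ext1 <;> assumption⟩))
  rcases le_total φ.val.fst.totalDegree φ.val.snd.totalDegree with hle | hle
  · exact main φ hN hle
  · have h1 : (swap * φ).val = ⟨φ.val.snd, φ.val.fst⟩ := by
      ext1 <;> simp [swap, mul_fst, mul_snd, pullback_X_zero, pullback_X_one]
    have h2 := main (swap * φ) (by rw [h1, ← hN]; exact add_comm _ _) (by rw [h1]; exact hle)
    have h3 : φ = swap * (swap * φ) := by
      rw [← mul_assoc, show (swap * swap : PlaneAut k) = 1 from Units.ext swap.val_inv, one_mul]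
    rw [h3]
    exact mul_mem hsw h2

/-! ### Ping-pong on degrees -/

/-- An affine map that is not triangular has a nonzero `x`-coefficient in its second component, so
there the larger degree `deg f` survives. -/
theorem totalDegree_snd_of_mem_affine {a ψ : PlaneAut k} (ha : a ∈ affine k)
    (hb : a ∉ triangular k) (hψ : ψ.val.snd.totalDegree < ψ.val.fst.totalDegree) :
    (a * ψ).val.fst.totalDegree ≤ (a * ψ).val.snd.totalDegree ∧
      (a * ψ).val.snd.totalDegree = ψ.val.fst.totalDegree := by
  obtain ⟨p, q, r, p', q', r', h⟩ := mem_affine.1 ha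
  have hp' : p' ≠ 0 := by
    rintro rfl
    refine hb (mem_triangular.2 ⟨p, Polynomial.C q * Polynomial.X + Polynomial.C r, q', r', ?_⟩)
    rw [h]
    ext1 <;> simp [add_assoc]
  rw [Units.val_mul, mul_fst, mul_snd, h]
  simp only [map_add, map_mul, pullback_C, pullback_X_zero, pullback_X_one]
  set f := ψ.val.fst
  set g := ψ.val.snd
  have h0 (x : k) := totalDegree_C (σ := Fin 2) x
  have h2 : (C p' * f + C q' * g + C r').totalDegree = f.totalDegree := by
    have e := totalDegree_C_mul_of_ne_zero hp' f
    have e2 : (C p' * f + C q' * g).totalDegree = f.totalDegree := by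
      rw [totalDegree_add_eq_left_of_totalDegree_lt, e]
      rw [e]
      exact (totalDegree_C_mul_le q' g).trans_lt hψ
    rw [totalDegree_add_eq_left_of_totalDegree_lt, e2]
    rw [e2, h0]
    omega
  rw [h2]
  refine ⟨?_, rfl⟩
  refine (totalDegree_add _ _).trans (max_le ((totalDegree_add _ _).trans (max_le ?_ ?_)) ?_)
  · exact totalDegree_C_mul_le p f
  · exact (totalDegree_C_mul_le q g).trans hψ.le
  · rw [h0]
    exact Nat.zero_le _

theorem totalDegree_pos (φ : PlaneAut k) :
    0 < φ.val.fst.totalDegree ∧ 0 < φ.val.snd.totalDegree := by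
  have hJ := jacobianDerivation_ne_zero (aeval_inv_fst φ) (aeval_inv_snd φ)
  rw [jacobianDerivation_apply] at hJ
  constructor
  · by_contra! h
    rw [Nat.le_zero, totalDegree_eq_zero_iff_eq_C] at h
    rw [h] at hJ
    simp at hJ
  · by_contra! h
    rw [Nat.le_zero, totalDegree_eq_zero_iff_eq_C] at h
    rw [h] at hJ
    simp at hJ

/-- A triangular map that is not affine has `deg P ≥ 2`, so `P(g)` has degree at least `2 deg g`.
This exceeds `deg g ≥ deg f`, because `g` is not constant. -/
theorem totalDegree_fst_of_mem_triangular {b ψ : PlaneAut k} (hb : b ∈ triangular k)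
    (ha : b ∉ affine k) (hψ : ψ.val.fst.totalDegree ≤ ψ.val.snd.totalDegree) :
    (b * ψ).val.snd.totalDegree < (b * ψ).val.fst.totalDegree ∧
      ψ.val.snd.totalDegree < (b * ψ).val.fst.totalDegree := by
  obtain ⟨p, P, q, r, h⟩ := mem_triangular.1 hb
  have hP : 2 ≤ P.natDegree := by
    by_contra! hlt
    obtain ⟨s, t, hst⟩ := Polynomial.exists_eq_X_add_C_of_natDegree_le_one (Nat.lt_succ_iff.1 hlt)
    refine ha (mem_affine.2 ⟨p, s, t, 0, q, r, ?_⟩)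
    rw [h, hst]
    ext1 <;> simp [add_assoc]
  have hpos := (totalDegree_pos ψ).2
  rw [Units.val_mul, mul_fst, mul_snd, h]
  simp only [map_add, map_mul, pullback_C, pullback_X_zero, pullback_X_one, pullback_aeval]
  set f := ψ.val.fst
  set g := ψ.val.snd
  have h0 (x : k) := totalDegree_C (σ := Fin 2) x
  have h1 := totalDegree_polynomial_aeval g P
  have h2 : 2 * g.totalDegree ≤ P.natDegree * g.totalDegree := Nat.mul_le_mul_right _ hP
  have h3 : (C p * f + Polynomial.aeval g P).totalDegree = P.natDegree * g.totalDegree := by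
    rw [totalDegree_add_eq_right_of_totalDegree_lt, h1]
    rw [h1]
    have := totalDegree_C_mul_le p f
    omega
  have h4 : (C q * g + C r).totalDegree ≤ g.totalDegree := by
    refine (totalDegree_add _ _).trans (max_le (totalDegree_C_mul_le q g) ?_)
    rw [h0]
    exact Nat.zero_le _
  omega

theorem exists_conj_mem_affine_or_triangular [IsAlgClosed k] [CharZero k] {φ : PlaneAut k}
    (hφ : IsOfFinOrder φ) :
    ∃ c : PlaneAut k, c * φ * c⁻¹ ∈ affine k ∨ c * φ * c⁻¹ ∈ triangular k := by
  refine exists_conj_mem_of_isOfFinOrder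
    (S := {ψ | ψ.val.snd.totalDegree < ψ.val.fst.totalDegree})
    (T := {ψ | ψ.val.fst.totalDegree ≤ ψ.val.snd.totalDegree})
    -- Twice the larger degree, less one on `S`: an affine letter preserves the larger degree but
    -- leaves `S`, and so still increases `D`.
    (D := fun ψ => if ψ.val.fst.totalDegree ≤ ψ.val.snd.totalDegree then
      2 * ψ.val.snd.totalDegree else 2 * ψ.val.fst.totalDegree - 1)
    ⟨shear (Polynomial.X ^ 2) 0, ?_⟩ ⟨1, ?_⟩ ?_ ?_ (mem_closure_affine_union_triangular φ) hφ
  · have h2 : ((X 1 : MvPolynomial (Fin 2) k) ^ 2).totalDegree = 2 := totalDegree_X_pow 1 2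
    simp only [Set.mem_ofPred_eq, shear, map_pow, Polynomial.aeval_X, C_0, add_zero]
    rw [totalDegree_add_eq_right_of_totalDegree_lt] <;> rw [h2, totalDegree_X] <;> norm_num
  · simp [one_fst, one_snd]
  · intro a ha hb ψ hψ
    obtain ⟨h1, h2⟩ := totalDegree_snd_of_mem_affine ha hb hψ
    refine ⟨h1, ?_⟩
    rw [Set.mem_ofPred_eq] at hψ
    rw [if_pos h1, if_neg (not_le.2 hψ), h2]
    omega
  · intro b hb ha ψ hψ
    obtain ⟨h1, h2⟩ := totalDegree_fst_of_mem_triangular hb ha hψ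
    refine ⟨h1, ?_⟩
    rw [Set.mem_ofPred_eq] at hψ
    rw [if_pos hψ, if_neg (not_le.2 h1)]
    omega

/-! ### Linearization of affine and triangular elements -/

/-- Triangular form requires a linear form that is an eigenvector, up to constants, of the pullback.
If `b = 0` it is `x`. Otherwise it is `y + μ x`, where comparing coefficients gives `b μ² + (d - a)
μ - c = 0`. -/
theorem exists_conj_mem_triangular_of_mem_affine [IsAlgClosed k] [CharZero k] {φ : PlaneAut k}
    (hφ : φ ∈ affine k) : ∃ c : PlaneAut k, c * φ * c⁻¹ ∈ triangular k := by
  obtain ⟨a, b, e, c, d, f, h⟩ := mem_affine.1 hφ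
  by_cases hb : b = 0
  · refine ⟨swap, mem_triangular.2
      ⟨d, Polynomial.C c * Polynomial.X + Polynomial.C f, a, e, ?_⟩⟩
    have hs : (swap⁻¹ : PlaneAut k) = swap := inv_eq_of_mul_eq_one_left (Units.ext swap.val_inv)
    rw [hs, Units.val_mul, Units.val_mul, h, hb]
    ext1
    · simp [swap, mul_fst, pullback_X_zero, pullback_X_one]
      ring
    · simp [swap, mul_snd, pullback_X_zero]
  · obtain ⟨s, hs⟩ := IsAlgClosed.exists_pow_nat_eq (discrim b (d - a) (-c)) (n := 2) two_pos
    obtain ⟨μ, hμ⟩ := exists_quadratic_eq_zero hb ⟨s, by rw [← hs, sq]⟩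
    refine ⟨lowerShear (Polynomial.C μ * Polynomial.X), mem_triangular.2
      ⟨a - b * μ, Polynomial.C b * Polynomial.X + Polynomial.C e, d + μ * b, f + μ * e, ?_⟩⟩
    have hinv : (lowerShear (Polynomial.C μ * Polynomial.X))⁻¹ =
        lowerShear (-(Polynomial.C μ * Polynomial.X)) :=
      inv_eq_of_mul_eq_one_right (lowerShear_mul_lowerShear_neg _)
    rw [hinv, Units.val_mul, Units.val_mul, h, coe_lowerShear, coe_lowerShear]
    ext1
    · simp [mul_fst, pullback_X_zero, pullback_X_one]
      ring
    · simp [mul_snd, pullback_X_zero, pullback_X_one]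
      have := congrArg (C (σ := Fin 2)) hμ
      simp only [C_add, C_mul, C_sub, C_neg, C_0] at this
      linear_combination (-X 0) * this

/-- Averaging over a finite cyclic group yields an eigenvector. -/
theorem map_sum_inv_pow_mul {L : MvPolynomial (Fin 2) k →ₐ[k] MvPolynomial (Fin 2) k}
    {t : ℕ → MvPolynomial (Fin 2) k} (ht : ∀ i, L (t i) = t (i + 1)) {N : ℕ} (hN : t N = t 0)
    {a : k} (ha : a ≠ 0) (haN : a ^ N = 1) :
    L (∑ i ∈ Finset.range N, C (a⁻¹ ^ i) * t i) =
      C a * ∑ i ∈ Finset.range N, C (a⁻¹ ^ i) * t i := by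
  have h1 : ∑ i ∈ Finset.range N, C (a⁻¹ ^ (i + 1)) * t (i + 1) =
      ∑ i ∈ Finset.range N, C (a⁻¹ ^ i) * t i := by
    have h2 := Finset.sum_range_succ (fun i => C (a⁻¹ ^ i) * t i) N
    rw [Finset.sum_range_succ', hN, inv_pow a N, haN, inv_one, pow_zero] at h2
    exact add_right_cancel h2
  rw [map_sum, ← h1, Finset.mul_sum]
  refine Finset.sum_congr rfl fun i _ => ?_
  rw [map_mul, ht, ← mul_assoc, ← C_mul, pow_succ', ← mul_assoc, mul_inv_cancel₀ ha, one_mul,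
    ← algebraMap_eq, AlgHom.commutes]

theorem exists_pow_eq_of_triangular {φ : PlaneAut k} {a b c : k} {P : Polynomial k}
    (h : (φ : PlaneEnd k) = ⟨C a * X 0 + Polynomial.aeval (X 1) P, C b * X 1 + C c⟩) (i : ℕ) :
    ∃ (Q : Polynomial k) (d : k), (φ ^ i).val =
      ⟨C (a ^ i) * X 0 + Polynomial.aeval (X 1) Q, C (b ^ i) * X 1 + C d⟩ := by
  induction i with
  | zero => exact ⟨0, 0, by ext1 <;> simp [one_fst, one_snd]⟩
  | succ i ih =>
    obtain ⟨Q, d, hQ⟩ := ih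
    refine ⟨Polynomial.C (a ^ i) * P + Q.comp (Polynomial.C b * Polynomial.X + Polynomial.C c),
      b ^ i * c + d, ?_⟩
    rw [pow_succ, Units.val_mul, hQ, h]
    ext1 <;> simp only [mul_fst, mul_snd, map_add, map_mul, pullback_C, pullback_X_zero,
      pullback_X_one, pullback_aeval, Polynomial.aeval_comp, Polynomial.aeval_C,
      Polynomial.aeval_X, algebraMap_eq, pow_succ] <;> ring

/-- Triangular automorphisms of finite order are linearizable. -/
theorem exists_conj_eq_diagonal_of_mem_triangular [CharZero k] {φ : PlaneAut k}
    (hφ : IsOfFinOrder φ) (ht : φ ∈ triangular k) :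
    ∃ (a b : kˣ) (α : PlaneAut k), α * φ * α⁻¹ = diagonal a b := by
  obtain ⟨a, P, b, c, h⟩ := mem_triangular.1 ht
  obtain ⟨N, hN, hpow⟩ := isOfFinOrder_iff_pow_eq_one.1 hφ
  choose Q d hQ using exists_pow_eq_of_triangular h
  have hone := hQ N
  rw [hpow] at hone
  -- Differentiating the first component of `φ ^ N = 1` in `x` removes the unknown polynomial in
  -- `y`.
  have haN : a ^ N = 1 := by
    have h1 := congrArg (fun f => pderiv 0 f.fst) hone
    simp [one_fst, Derivation.map_aeval] at h1
    rw [← C_pow, ← C_1] at h1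
    exact (C_injective _ _ h1).symm
  have hbN : b ^ N = 1 := by
    have h1 := congrArg (fun f => pderiv 1 f.snd) hone
    simp [one_snd] at h1
    rw [← C_pow, ← C_1] at h1
    exact (C_injective _ _ h1).symm
  have ha : a ≠ 0 := by
    rintro rfl
    simp [hN.ne'] at haN
  have hb : b ≠ 0 := by
    rintro rfl
    simp [hN.ne'] at hbN
  have hN0 : (N : k) ≠ 0 := by exact_mod_cast hN.ne'
  -- Pullback along `φ` sends the components of `φ ^ i` to those of `φ ^ (i + 1)`, so the weighted
  -- sums are eigenvectors with eigenvalues `a` and `b`.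
  have e1 := map_sum_inv_pow_mul (L := φ.val.pullback) (t := fun i => (φ ^ i).val.fst) (N := N)
    (fun i => by rw [pow_succ]; rfl) (by simp [hpow]) ha haN
  have e2 := map_sum_inv_pow_mul (L := φ.val.pullback) (t := fun i => (φ ^ i).val.snd) (N := N)
    (fun i => by rw [pow_succ]; rfl) (by simp [hpow]) hb hbN
  let Q' : Polynomial k := Polynomial.C (N : k)⁻¹ *
    ∑ i ∈ Finset.range N, Polynomial.C (a⁻¹ ^ i) * Q i
  let d' : k := (N : k)⁻¹ * ∑ i ∈ Finset.range N, b⁻¹ ^ i * d i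
  have hcan : ∀ x : k, x ≠ 0 → ∀ (i : ℕ) (y : MvPolynomial (Fin 2) k),
      C (x⁻¹ ^ i) * (C (x ^ i) * y) = y := by
    intro x hx i y
    rw [← mul_assoc, ← C_mul, ← mul_pow, inv_mul_cancel₀ hx, one_pow, C_1, one_mul]
  have hNC : ∀ y : MvPolynomial (Fin 2) k, C (N : k)⁻¹ * (N • y) = y := by
    intro y
    rw [nsmul_eq_mul, ← mul_assoc, ← map_natCast (C (σ := Fin 2) (R := k)), ← C_mul,
      inv_mul_cancel₀ hN0, C_1, one_mul]
  -- Each twisted summand is `x` plus a polynomial in `y`, so after division by `N` the average is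
  -- the first component of a shear; likewise for `y`.
  have s1 : C (N : k)⁻¹ * ∑ i ∈ Finset.range N, C (a⁻¹ ^ i) * (φ ^ i).val.fst =
      X 0 + Polynomial.aeval (X 1) Q' := by
    simp only [hQ, mul_add, hcan a ha, Finset.sum_add_distrib, Finset.sum_const,
      Finset.card_range, hNC, Q', map_mul, map_sum, Polynomial.aeval_C, algebraMap_eq]
  have s2 : C (N : k)⁻¹ * ∑ i ∈ Finset.range N, C (b⁻¹ ^ i) * (φ ^ i).val.snd = X 1 + C d' := by
    simp only [hQ, mul_add, hcan b hb, Finset.sum_add_distrib, Finset.sum_const,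
      Finset.card_range, hNC, d', map_mul, map_sum]
  clear_value Q' d'
  refine ⟨Units.mk0 a ha, Units.mk0 b hb, shear Q' d', ?_⟩
  rw [mul_inv_eq_iff_eq_mul]
  apply Units.ext
  rw [Units.val_mul, Units.val_mul]
  ext1
  -- The two components of `α * φ = δ * α` are the eigenvector equations `e1` and `e2`.
  · change φ.val.pullback (X 0 + Polynomial.aeval (X 1) Q') = (shear Q' d').val.pullback (C a * X 0)
    rw [map_mul, pullback_C, pullback_X_zero]
    change _ = C a * (X 0 + Polynomial.aeval (X 1) Q')
    rw [← s1, map_mul, pullback_C, e1]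
    ring
  · change φ.val.pullback (X 1 + C d') = (shear Q' d').val.pullback (C b * X 1)
    rw [map_mul, pullback_C, pullback_X_one]
    change _ = C b * (X 1 + C d')
    rw [← s2, map_mul, pullback_C, e2]
    ring

end PlaneAut

theorem mainTheorem8 (k : Type*) [Field k] [IsAlgClosed k] [CharZero k]
    (φ : PlaneAut k) (hφ : IsOfFinOrder φ) :
    ∃ δ : PlaneAut k, PlaneAut.IsDiagonal δ ∧ ∃ α : PlaneAut k, α * φ * α⁻¹ = δ := by
  have htri : ∃ c : PlaneAut k, c * φ * c⁻¹ ∈ PlaneAut.triangular k := by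
    obtain ⟨c, hc | hc⟩ := PlaneAut.exists_conj_mem_affine_or_triangular hφ
    · obtain ⟨d, hd⟩ := PlaneAut.exists_conj_mem_triangular_of_mem_affine hc
      exact ⟨d * c, by simpa [mul_assoc] using hd⟩
    · exact ⟨c, hc⟩
  obtain ⟨c, hc⟩ := htri
  have hfin : IsOfFinOrder (c * φ * c⁻¹) := by
    obtain ⟨n, hn, hpow⟩ := isOfFinOrder_iff_pow_eq_one.1 hφ
    exact isOfFinOrder_iff_pow_eq_one.2 ⟨n, hn, by rw [conj_pow, hpow, mul_one, mul_inv_cancel]⟩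
  obtain ⟨a, b, α, h⟩ := PlaneAut.exists_conj_eq_diagonal_of_mem_triangular hfin hc
  exact ⟨PlaneAut.diagonal a b, ⟨a, b, a.ne_zero, b.ne_zero, rfl⟩, α * c, by
    rw [← h]
    group⟩
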